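/- Consider a server with $N$ independent files $W_1,\dots,W_N$, each uniformly distributed on $[2^F]=\{1,\dots,2^F\}$, and $K$ users. For real $M,R\ge 0$ and an integer $F\ge 1$, an $(M,R,F)$ caching and delivery code consists of caching functions $\phi_k:[2^F]^N\to[2^{\lfloor FM\rfloor}]$, $k\in[K]$, a delivery function $\psi:[2^F]^N\times[N]^K\to[2^{\lfloor FR\rfloor}]$, and decoding functions $\mu_k:[2^{\lfloor FM\rfloor}]\times[2^{\lfloor FR\rfloor}]\times[N]^K\to[2^F]$, $k\in[K]$. With $\mathbf W=(W_1,\dots,W_N)$ and $\hat W_k=\mu_k(\phi_k(\mathbf W),\psi(\mathbf W,\mathbf d),\mathbf d)$, its error probability is $$P_e=\max_{\mathbf d\in[N]^K}\Pr\Big\{\bigcup_{k=1}^K\{\hat W_k\ne W_{d_k}\}\Big\}.$$ The pair $(R,M)$ is achievable if for every $\varepsilon>0$ there are an $F\ge 1$ and an $(M,R,F)$ code with $P_e<\varepsilon$, and the optimal delivery rate is $R^*(M)=\inf\{R\ge 0:(R,M)\text{ is achievable}\}$. **Theorem.** Let $K>N\ge 3$ be integers, let $M\in[1/K,(N-1)/K]$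 be real, and let $$R_c(M)=-N\Big(\frac M2-1+\frac1{2K}\Big)$$ be the delivery rate of the proposed coded caching scheme. Then $R_c(M)$ is achieved, in the sense that $(R,M)$ is achievable for every $R>R_c(M)$ (so $R^*(M)\le R_c(M)$); moreover $R^*(M)>0$ and $$\frac{R_c(M)}{R^*(M)}\le 2 .$$ -/

import Mathlib

/-- An `(M, R, F)` caching and delivery code for `N` files of `F` bits and `K` users.
A file is an element of `Fin (2 ^ F)`, a database is a map `Fin N → Fin (2 ^ F)` and a demand
vector is a map `Fin K → Fin N`. The code is only used with `0 ≤ M` and `0 ≤ R`, where the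
natural-number floor is the usual floor. -/
structure CachingCode (N K : ℕ) (M R : ℝ) (F : ℕ) where
  /-- the caching functions, giving the cache content of each user -/
  cache : Fin K → (Fin N → Fin (2 ^ F)) → Fin (2 ^ ⌊(F : ℝ) * M⌋₊)
  /-- the delivery encoding function, giving the message over the shared link -/
  encode : (Fin N → Fin (2 ^ F)) → (Fin K → Fin N) → Fin (2 ^ ⌊(F : ℝ) * R⌋₊)
  /-- the decoding functions -/
  decode : Fin K → Fin (2 ^ ⌊(F : ℝ) * M⌋₊) → Fin (2 ^ ⌊(F : ℝ) * R⌋₊) →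
    (Fin K → Fin N) → Fin (2 ^ F)

namespace CachingCode

variable {N K F : ℕ} {M R : ℝ}

/-- The file that user `k` reconstructs when the database is `W` and the demand vector is `d`. -/
def reconstruct (C : CachingCode N K M R F) (W : Fin N → Fin (2 ^ F)) (d : Fin K → Fin N)
    (k : Fin K) : Fin (2 ^ F) :=
  C.decode k (C.cache k W) (C.encode W d) d

/-- The probability, for the demand vector `d`, that some user fails to reconstruct the file it
requested. The files are independent and uniform, so the database is uniformly distributed. -/
noncomputable def errorProbOf (C : CachingCode N K M R F) (d : Fin K → Fin N) : ℝ :=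
  ((Finset.univ.filter fun W : Fin N → Fin (2 ^ F) =>
      ∃ k, C.reconstruct W d k ≠ W (d k)).card : ℝ) /
    (Fintype.card (Fin N → Fin (2 ^ F)) : ℝ)

/-- The probability of error of a code: the maximum over the (finitely many) demand vectors. -/
noncomputable def errorProb (C : CachingCode N K M R F) : ℝ :=
  ⨆ d : Fin K → Fin N, C.errorProbOf d

end CachingCode

/-- The delivery rate-cache capacity pair `(R, M)` is achievable: for every `ε > 0` there are a
file length `F ≥ 1` and an `(M, R, F)` code whose probability of error is below `ε`.
Asking for `F` to exceed an arbitrary bound gives the same notion, since a code of length `F` can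
be repeated on consecutive blocks. -/
def Achievable (N K : ℕ) (R M : ℝ) : Prop :=
  0 ≤ R ∧ ∀ ε : ℝ, 0 < ε → ∃ F : ℕ, 0 < F ∧ ∃ C : CachingCode N K M R F, C.errorProb < ε

/-- The optimal delivery rate `R*(M)`. -/
noncomputable def optimalRate (N K : ℕ) (M : ℝ) : ℝ :=
  sInf {R : ℝ | Achievable N K R M}

/-- The delivery rate `R_c(M)` of the proposed scheme for `1 / K ≤ M ≤ (N - 1) / K`. -/
noncomputable def proposedRate (N K : ℕ) (M : ℝ) : ℝ :=
  -(N : ℝ) * (1 / 2 * M - 1 + 1 / (2 * (K : ℝ)))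

/-! The graph of $R_c$ is the line through two error-free schemes with $K$ symbols per file:
`codedPrefetching` at $(M,R)=(1/K,\,N-N/K)$ and `uncodedPrefetching` at $(N/K,\,N-N(N+1)/(2K))$.
Running them on suitable proportions of the blocks reaches every rate above the line. Conversely,
$\lceil N/2\rceil$ caches and two messages determine all files, so $N\le\lceil N/2\rceil M+2R$.
Since $\lceil N/2\rceil\le(N+1)/2$ and $M\le N/K$, this gives $2R\ge R_c(M)$. -/

/-- Zero-error caching with message alphabets of at most `y` letters: the cache contents are letters
of `X`, and for each demand vector the cache of a user and the message determine the requested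
file. -/
def ZeroErrorScheme (N K : ℕ) (A X : Type) (y : ℕ) : Prop :=
  ∃ cache : Fin K → (Fin N → A) → X, ∀ d : Fin K → Fin N,
    ∃ (Y : Type) (_ : Fintype Y), Fintype.card Y ≤ y ∧ ∃ enc : (Fin N → A) → Y,
      ∀ k W W', cache k W = cache k W' → enc W = enc W' → W (d k) = W' (d k)

namespace ZeroErrorScheme

variable {N K : ℕ} {A A' X X' : Type} {y y' : ℕ}

/-- Each file is cut into two parts served independently; this is memory sharing. -/
theorem prod (h : ZeroErrorScheme N K A X y) (h' : ZeroErrorScheme N K A' X' y') :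
    ZeroErrorScheme N K (A × A') (X × X') (y * y') := by
  obtain ⟨c, hc⟩ := h
  obtain ⟨c', hc'⟩ := h'
  refine ⟨fun k W => (c k fun n => (W n).1, c' k fun n => (W n).2), fun d => ?_⟩
  obtain ⟨Y, _, hY, e, he⟩ := hc d
  obtain ⟨Y', _, hY', e', he'⟩ := hc' d
  refine ⟨Y × Y', inferInstance, ?_,
    fun W => (e fun n => (W n).1, e' fun n => (W n).2), fun k W W' h₁ h₂ => ?_⟩
  · rw [Fintype.card_prod]
    exact Nat.mul_le_mul hY hY'
  · rw [Prod.mk.injEq] at h₁ h₂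
    exact Prod.ext (he k _ _ h₁.1 h₂.1) (he' k _ _ h₁.2 h₂.2)

theorem pi (h : ZeroErrorScheme N K A X y) (m : ℕ) :
    ZeroErrorScheme N K (Fin m → A) (Fin m → X) (y ^ m) := by
  obtain ⟨c, hc⟩ := h
  refine ⟨fun k W i => c k fun n => W n i, fun d => ?_⟩
  obtain ⟨Y, _, hY, e, he⟩ := hc d
  refine ⟨Fin m → Y, inferInstance, ?_, fun W i => e fun n => W n i, fun k W W' h₁ h₂ => ?_⟩
  · rw [Fintype.card_fun, Fintype.card_fin]
    exact Nat.pow_le_pow_left hY m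
  · funext i
    exact he k _ _ (congrFun h₁ i) (congrFun h₂ i)

/-- A zero-error scheme over alphabets of the right sizes yields a code without errors. -/
theorem exists_code [Fintype A] [Fintype X] {F : ℕ} {M R : ℝ} (h : ZeroErrorScheme N K A X y)
    (hA : Fintype.card A = 2 ^ F) (hX : Fintype.card X ≤ 2 ^ ⌊(F : ℝ) * M⌋₊)
    (hy : y ≤ 2 ^ ⌊(F : ℝ) * R⌋₊) :
    ∃ C : CachingCode N K M R F, C.errorProb = 0 := by
  classical
  obtain ⟨c, hc⟩ := h
  choose Y _ hY e he using hc
  let α : Fin (2 ^ F) ≃ A := (Fintype.equivFinOfCardEq hA).symm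
  obtain ⟨ι⟩ : Nonempty (X ↪ Fin (2 ^ ⌊(F : ℝ) * M⌋₊)) :=
    Function.Embedding.nonempty_of_card_le (by simpa using hX)
  have hκ : ∀ d, Nonempty (Y d ↪ Fin (2 ^ ⌊(F : ℝ) * R⌋₊)) := fun d =>
    Function.Embedding.nonempty_of_card_le (by simpa using (hY d).trans hy)
  let κ := fun d => (hκ d).some
  let cache : Fin K → (Fin N → Fin (2 ^ F)) → Fin (2 ^ ⌊(F : ℝ) * M⌋₊) :=
    fun k W => ι (c k (α ∘ W))
  let encode : (Fin N → Fin (2 ^ F)) → (Fin K → Fin N) → Fin (2 ^ ⌊(F : ℝ) * R⌋₊) :=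
    fun W d => κ d (e d (α ∘ W))
  have key : ∀ d k W W', cache k W = cache k W' → encode W d = encode W' d →
      W (d k) = W' (d k) := fun d k W W' h₁ h₂ =>
    α.injective (he d k _ _ (ι.injective h₁) ((κ d).injective h₂))
  let C : CachingCode N K M R F :=
    { cache := cache
      encode := encode
      -- Any database consistent with the observations gives the right file; the default 0 never
      -- occurs on a real transmission.
      decode := fun k x z d =>
        if h : ∃ W, cache k W = x ∧ encode W d = z then h.choose (d k)
        else ⟨0, by positivity⟩ }
  have hC : ∀ W d k, C.reconstruct W d k = W (d k) := by
    intro W d k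
    have h : ∃ W', cache k W' = cache k W ∧ encode W' d = encode W d := ⟨W, rfl, rfl⟩
    have hrec : C.reconstruct W d k = h.choose (d k) := dif_pos h
    rw [hrec]
    exact key d k _ _ h.choose_spec.1 h.choose_spec.2
  refine ⟨C, ?_⟩
  have h0 : ∀ d, C.errorProbOf d = 0 := fun d => by
    simp [CachingCode.errorProbOf, hC]
  simp [CachingCode.errorProb, h0]

/-! ### The two prefetching schemes -/

/-- Coded prefetching: every file consists of `K` symbols, and user `k` caches the sum of the
`k`-th symbols of all files. -/
theorem codedPrefetching (hNK : N ≤ K) :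
    ZeroErrorScheme N K (Fin K → ZMod 2) (ZMod 2) (2 ^ (N * K - N)) := by
  classical
  refine ⟨fun k W => ∑ n, W n k, fun d => ?_⟩
  by_cases hd : Function.Surjective d
  · obtain ⟨l, hl⟩ := hd.hasRightInverse
    -- User `l n` requests file `n`. Symbols of file `n` indexed by users not requesting it are sent
    -- raw, the others as differences from symbol `l n`: `K - 1` symbols per file.
    refine ⟨(n : Fin N) → {k : Fin K // k ≠ l n} → ZMod 2, inferInstance, ?_,
      fun W n k => if d k = n then W n k - W n (l n) else W n k, fun k W W' h₁ h₂ => ?_⟩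
    · simp [ZMod.card, ← pow_mul, mul_comm N, Nat.sub_mul]
    · have hraw : ∀ n j, d j ≠ n → W n j = W' n j := by
        intro n j hj
        have hjl : j ≠ l n := fun h => hj (by rw [h, hl n])
        have := congrFun (congrFun h₂ n) ⟨j, hjl⟩
        simpa [hj] using this
      have hdiff : ∀ n j, d j = n → W n j - W n (l n) = W' n j - W' n (l n) := by
        intro n j hj
        by_cases hjl : j = l n
        · rw [hjl, sub_self, sub_self]
        · have := congrFun (congrFun h₂ n) ⟨j, hjl⟩
          simpa [hj] using this
      -- The `k`-th symbols of all other files were sent raw, so the cached sum yields this one; the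
      -- differences then unlock the rest of the file.
      have hk : W (d k) k = W' (d k) k := by
        have h₁ : ∑ n, W n k = ∑ n, W' n k := h₁
        rw [← Finset.add_sum_erase _ _ (Finset.mem_univ (d k)),
          ← Finset.add_sum_erase (Finset.univ) (fun n => W' n k) (Finset.mem_univ (d k)),
          Finset.sum_congr rfl fun n hn => hraw n k (Finset.ne_of_mem_erase hn).symm] at h₁
        exact add_right_cancel h₁
      have hlead : W (d k) (l (d k)) = W' (d k) (l (d k)) := by
        have := hdiff (d k) k rfl
        rw [hk] at this
        exact sub_right_injective this
      funext j
      by_cases hj : d j = d k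
      · have := hdiff (d k) j hj
        rw [hlead] at this
        exact sub_left_injective this
      · exact hraw _ _ hj
  -- Some file is unrequested: sending the others whole costs `N * K - K ≤ N * K - N` symbols.
  · obtain ⟨n₀, hn₀⟩ := not_forall.mp hd
    refine ⟨{n : Fin N // n ≠ n₀} → Fin K → ZMod 2, inferInstance, ?_,
      fun W n => W n, fun k W W' _ h₂ => ?_⟩
    · simp only [Fintype.card_fun, ZMod.card, Fintype.card_fin, ← pow_mul, ne_eq,
        Fintype.card_subtype_compl, Fintype.card_subtype_eq]
      refine Nat.pow_le_pow_right two_pos ?_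
      rw [Nat.mul_sub, mul_comm K N, mul_one]
      omega
    · exact congrFun h₂ ⟨d k, fun h => hn₀ ⟨k, h⟩⟩

/-- There are `N` distinct users whose demands cover all demanded files. -/
theorem exists_leaders (hNK : N ≤ K) (d : Fin K → Fin N) :
    ∃ l : Fin N → Fin K, Function.Injective l ∧ ∀ k, ∃ n, d (l n) = d k := by
  classical
  have hex : ∀ m : Set.range d, ∃ k, d k = m := fun m => m.2
  choose s hs using hex
  obtain ⟨S, hsS, -, hS⟩ := Finset.exists_subsuperset_card_eq
    (Finset.subset_univ ((Finset.univ : Finset (Set.range d)).image s)) (n := N)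
    (Finset.card_image_le.trans
      ((Fintype.card_le_of_injective _ Subtype.val_injective).trans_eq (Fintype.card_fin N)))
    (by simpa using hNK)
  refine ⟨S.orderEmbOfFin hS, (S.orderEmbOfFin hS).injective, fun k => ?_⟩
  have hmem : s ⟨d k, k, rfl⟩ ∈ S := hsS (Finset.mem_image_of_mem _ (Finset.mem_univ _))
  rw [← Finset.mem_coe, ← Finset.range_orderEmbOfFin S hS] at hmem
  obtain ⟨n, hn⟩ := hmem
  exact ⟨n, by rw [hn, hs]⟩

/-- Uncoded prefetching: every file consists of `K` symbols, and user `k` caches the `k`-th symbol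
of each file. -/
theorem uncodedPrefetching (hNK : N ≤ K) :
    ZeroErrorScheme N K (Fin K → ZMod 2) (Fin N → ZMod 2)
      (2 ^ ∑ n : Fin N, (K - (n + 1))) := by
  classical
  refine ⟨fun k W n => W n k, fun d => ?_⟩
  obtain ⟨l, hinj, hl⟩ := exists_leaders hNK d
  -- One pair sum is sent for each unordered pair of distinct users containing a leader; earlier
  -- leaders are excluded to avoid repeats.
  refine ⟨(n : Fin N) → {j : Fin K // j ∉ (Finset.Iic n).image l} → ZMod 2, inferInstance, ?_,
    fun W n j => W (d (l n)) j + W (d j) (l n), fun k W W' h₁ h₂ => ?_⟩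
  · simp [ZMod.card, Finset.prod_pow_eq_pow_sum, -Finset.mem_image,
      Finset.card_image_of_injective _ hinj, Fintype.card_subtype_compl]
  · let T : (Fin N → Fin K → ZMod 2) → Fin K → Fin K → ZMod 2 :=
      fun V i j => V (d i) j + V (d j) i
    have hsymm : ∀ V i j, T V i j = T V j i := fun V i j => add_comm _ _
    have hself : ∀ V i, T V i i = 0 := fun V i => CharTwo.add_self_eq_zero _
    have hsent : ∀ n j, j ∉ (Finset.Iic n).image l → T W (l n) j = T W' (l n) j :=
      fun n j hj => congrFun (congrFun h₂ n) ⟨j, hj⟩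
    have hlead : ∀ n j, T W (l n) j = T W' (l n) j := by
      intro n j
      by_cases hj : j ∈ (Finset.Iic n).image l
      · obtain ⟨m, hm, rfl⟩ := Finset.mem_image.mp hj
        rcases (Finset.mem_Iic.mp hm).eq_or_lt with rfl | hlt
        · rw [hself, hself]
        · rw [hsymm, hsymm W']
          refine hsent m (l n) fun h => ?_
          obtain ⟨m', hm', he⟩ := Finset.mem_image.mp h
          rw [hinj he] at hm'
          exact absurd (Finset.mem_Iic.mp hm') (not_le.mpr hlt)
      · exact hsent n j hj
    have hall : ∀ i j, T W i j = T W' i j := by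
      intro i j
      obtain ⟨u, hu⟩ := hl i
      obtain ⟨v, hv⟩ := hl j
      -- Leaders `l u`, `l v` request the same files as `i`, `j`, so in characteristic 2 an unsent
      -- pair sum telescopes into pair sums involving leaders.
      have hT : ∀ V, T V i j = T V (l v) i - T V (l u) (l v) + T V (l u) j := by
        intro V
        simp only [T, hu, hv]
        ring
      rw [hT W, hT W', hlead, hlead, hlead]
    funext j
    have h := hall k j
    have hc : W (d j) k = W' (d j) k := congrFun h₁ (d j)
    simp only [T, hc] at h
    exact add_right_cancel h

end ZeroErrorScheme

/-! ### Memory sharing and achievability -/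

theorem cast_sum_leader_pairs {N K : ℕ} (hNK : N ≤ K) :
    ((∑ n : Fin N, (K - (n + 1)) : ℕ) : ℝ) = N * K - N * (N + 1) / 2 := by
  rw [Fin.sum_univ_eq_sum_range fun n => K - (n + 1)]
  induction N with
  | zero => simp
  | succ m ih =>
    rw [Finset.sum_range_succ, Nat.cast_add, ih (Nat.le_of_succ_le hNK), Nat.cast_sub hNK]
    push_cast
    ring

/-- Memory sharing between `a` copies of the coded and `b` copies of the uncoded prefetching
scheme. -/
theorem exists_code_of_memory_sharing {N K a b : ℕ} {M R : ℝ} (hNK : N ≤ K)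
    (hM : (a + b * N : ℝ) ≤ K * (a + b) * M)
    (hR : (a * (N * K - N) + b * (N * K - N * (N + 1) / 2) : ℝ) ≤ K * (a + b) * R) :
    ∃ C : CachingCode N K M R (K * (a + b)), C.errorProb = 0 := by
  refine (((ZeroErrorScheme.codedPrefetching hNK).pi a).prod
    ((ZeroErrorScheme.uncodedPrefetching hNK).pi b)).exists_code ?_ ?_ ?_
  · simp [ZMod.card, ← pow_mul, ← pow_add, mul_add]
  · have h : a + N * b ≤ ⌊((K * (a + b) : ℕ) : ℝ) * M⌋₊ := Nat.le_floor (by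
      push_cast
      linarith)
    simpa [ZMod.card, ← pow_mul, ← pow_add] using Nat.pow_le_pow_right two_pos h
  · rw [← pow_mul, ← pow_mul, ← pow_add]
    refine Nat.pow_le_pow_right two_pos (Nat.le_floor ?_)
    have hle : N ≤ N * K := by
      rcases Nat.eq_zero_or_pos N with rfl | h
      · simp
      · exact Nat.le_mul_of_pos_right _ (h.trans_le hNK)
    rw [Nat.cast_add, Nat.cast_mul, Nat.cast_mul, cast_sum_leader_pairs hNK, Nat.cast_sub hle]
    push_cast
    linarith

theorem proposedRate_pos {N K : ℕ} {M : ℝ} (hN : 0 < N) (hK : N < K)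
    (hM : M ≤ ((N : ℝ) - 1) / K) : 0 < proposedRate N K M := by
  have hN' : (1 : ℝ) ≤ N := by exact_mod_cast hN
  have hK' : (N : ℝ) + 1 ≤ K := by exact_mod_cast hK
  have hK0 : (0 : ℝ) < K := by linarith
  have hKM : M + 1 / K < 1 := by
    calc M + 1 / K ≤ ((N : ℝ) - 1) / K + 1 / K := by gcongr
      _ = N / K := by ring
      _ < 1 := by rw [div_lt_one hK0]; linarith
  have h : proposedRate N K M = N * (1 - (M + 1 / K) / 2) := by
    rw [proposedRate]
    field_simp
    ring
  rw [h]
  exact mul_pos (by linarith) (by linarith)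

theorem achievable_of_proposedRate_lt {N K : ℕ} (hN : 2 ≤ N) (hK : N < K) {M R : ℝ}
    (hM₁ : 1 / (K : ℝ) ≤ M) (hM₂ : M ≤ ((N : ℝ) - 1) / (K : ℝ))
    (hR : proposedRate N K M < R) : Achievable N K R M := by
  have hpos := proposedRate_pos (by omega) hK hM₂
  refine ⟨(hpos.trans hR).le, fun ε hε => ?_⟩
  have hN' : (2 : ℝ) ≤ N := by exact_mod_cast hN
  have hK' : (N : ℝ) + 1 ≤ K := by exact_mod_cast hK
  have hK0 : (0 : ℝ) < K := by linarith
  have hN1 : (0 : ℝ) < N - 1 := by linarith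
  rw [div_le_iff₀ hK0] at hM₁
  rw [le_div_iff₀ hK0] at hM₂
  -- the fraction of the file handled by uncoded prefetching
  obtain ⟨t, ht⟩ : ∃ t : ℝ, t * (N - 1) = M * K - 1 := ⟨(M * K - 1) / (N - 1), by field_simp⟩
  have ht0 : 0 ≤ t := by
    by_contra! h
    nlinarith
  have ht1 : t ≤ 1 := by
    by_contra! h
    nlinarith
  have hrate : K * proposedRate N K M = N * K - N - t * (N * (N - 1) / 2) := by
    rw [show t * ((N : ℝ) * (N - 1) / 2) = N / 2 * (t * (N - 1)) by ring, ht, proposedRate]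
    field_simp
    ring
  have hgap : 0 < K * (R - proposedRate N K M) := mul_pos hK0 (by linarith)
  -- Of `L` blocks, `⌊t * L⌋₊` use uncoded prefetching. Rounding down keeps the cache within budget
  -- and costs less than `N * (N - 1) / 2` extra symbols, which the rate slack absorbs for this `L`.
  obtain ⟨L, hL⟩ := exists_nat_gt ((N * (N - 1) / 2 : ℝ) / (K * (R - proposedRate N K M)))
  rw [div_lt_iff₀ hgap] at hL
  have hL0 : 0 < L := by
    rcases Nat.eq_zero_or_pos L with rfl | h
    · have : (0 : ℝ) ≤ N * (N - 1) / 2 := by positivity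
      simp only [Nat.cast_zero, zero_mul] at hL
      linarith
    · exact h
  have htL : 0 ≤ t * L := by positivity
  obtain ⟨b, hb⟩ : ∃ b, b = ⌊t * L⌋₊ := ⟨_, rfl⟩
  have hb1 : (b : ℝ) ≤ t * L := hb ▸ Nat.floor_le htL
  have hb2 : t * L < b + 1 := hb ▸ Nat.lt_floor_add_one _
  have hbL : b ≤ L := by
    have : t * L ≤ 1 * L := by gcongr
    exact_mod_cast (hb1.trans this).trans_eq (one_mul _)
  obtain ⟨a, rfl⟩ := Nat.exists_eq_add_of_le' hbL
  push_cast at *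
  obtain ⟨C, hC⟩ := exists_code_of_memory_sharing (a := a) (b := b) (M := M) (R := R) hK.le
    (by
      have := mul_le_mul_of_nonneg_right hb1 hN1.le
      rw [mul_right_comm, ht] at this
      linarith)
    (by
      have hc : (0 : ℝ) ≤ N * (N - 1) / 2 := by positivity
      have h := mul_le_mul_of_nonneg_right hb2.le hc
      have e : (a + b : ℝ) * (K * (R - proposedRate N K M)) =
        K * (a + b) * R - (a + b) * (K * proposedRate N K M) := by ring
      rw [e, hrate] at hL
      linarith)
  exact ⟨K * (a + b), Nat.mul_pos (by omega) hL0, C, hC ▸ hε⟩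

/-! ### Converse -/

/-- The cut-set bound for two transmissions: the caches of `s` users and the messages for two
demand vectors that cover all files determine the database. -/
theorem Achievable.le_of_two_demands {N K s : ℕ} {M R : ℝ} (h : Achievable N K R M) (hM : 0 ≤ M)
    (u : Fin s → Fin K) (d₁ d₂ : Fin K → Fin N)
    (hcover : ∀ n, ∃ i, d₁ (u i) = n ∨ d₂ (u i) = n) :
    (N : ℝ) ≤ s * M + 2 * R := by
  classical
  obtain ⟨hR, h⟩ := h
  -- With error below 1/4 for each of two demands, more than half of the databases decode correctly
  -- under both. The lost factor is below 2, and integrality of the exponents removes it.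
  obtain ⟨F, hF, C, hC⟩ := h (1 / 4) (by norm_num)
  let bad : (Fin K → Fin N) → Finset (Fin N → Fin (2 ^ F)) := fun d =>
    Finset.univ.filter fun W => ∃ k, C.reconstruct W d k ≠ W (d k)
  have hcard : (Fintype.card (Fin N → Fin (2 ^ F)) : ℝ) = 2 ^ (F * N) := by
    simp [pow_mul]
  have hbad : ∀ d, ((bad d).card : ℝ) < 1 / 4 * 2 ^ (F * N) := by
    intro d
    have h₁ : C.errorProbOf d ≤ C.errorProb := le_ciSup (Set.finite_range _).bddAbove d
    have h₂ := h₁.trans_lt hC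
    rw [CachingCode.errorProbOf, hcard, div_lt_iff₀ (by positivity)] at h₂
    exact h₂
  let good := (bad d₁ ∪ bad d₂)ᶜ
  have hgood : (2 : ℝ) ^ (F * N) < 2 * good.card := by
    have h₁ : (good.card : ℝ) + (bad d₁ ∪ bad d₂).card = 2 ^ (F * N) := by
      rw [← hcard, ← Finset.card_compl_add_card (bad d₁ ∪ bad d₂)]
      push_cast
      rfl
    have h₂ : ((bad d₁ ∪ bad d₂).card : ℝ) ≤ (bad d₁).card + (bad d₂).card := by
      exact_mod_cast Finset.card_union_le _ _
    linarith [hbad d₁, hbad d₂]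
  let view : (Fin N → Fin (2 ^ F)) →
      (Fin s → Fin (2 ^ ⌊(F : ℝ) * M⌋₊)) × Fin (2 ^ ⌊(F : ℝ) * R⌋₊) × Fin (2 ^ ⌊(F : ℝ) * R⌋₊) :=
    fun W => (fun i => C.cache (u i) W, C.encode W d₁, C.encode W d₂)
  have hdec : ∀ W ∈ good, ∀ k, C.reconstruct W d₁ k = W (d₁ k) ∧
      C.reconstruct W d₂ k = W (d₂ k) := by
    intro W hW k
    simp only [good, bad, Finset.mem_compl, Finset.mem_union, Finset.mem_filter,
      Finset.mem_univ, true_and, not_or, not_exists, not_not] at hW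
    exact ⟨hW.1 k, hW.2 k⟩
  have hinj : Set.InjOn view good := by
    intro W hW W' hW' hv
    simp only [view, Prod.mk.injEq] at hv
    obtain ⟨hc, he₁, he₂⟩ := hv
    funext n
    obtain ⟨i, hi | hi⟩ := hcover n
    · rw [← hi, ← (hdec W hW (u i)).1, ← (hdec W' hW' (u i)).1]
      simp only [CachingCode.reconstruct, congrFun hc i, he₁]
    · rw [← hi, ← (hdec W hW (u i)).2, ← (hdec W' hW' (u i)).2]
      simp only [CachingCode.reconstruct, congrFun hc i, he₂]
  have hle : good.card ≤ 2 ^ (⌊(F : ℝ) * M⌋₊ * s + 2 * ⌊(F : ℝ) * R⌋₊) := by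
    refine (Finset.card_le_card_of_injOn view (fun _ _ => Finset.mem_univ _) hinj).trans_eq ?_
    simp [← pow_mul, ← pow_add, two_mul]
  have hexp : F * N < 1 + (⌊(F : ℝ) * M⌋₊ * s + 2 * ⌊(F : ℝ) * R⌋₊) := by
    refine (Nat.pow_lt_pow_iff_right (a := 2) one_lt_two).mp ?_
    have h₁ : 2 ^ (F * N) < 2 * good.card := by exact_mod_cast hgood
    rw [pow_add]
    omega
  have hexp' : (F * N : ℝ) ≤ ⌊(F : ℝ) * M⌋₊ * s + 2 * ⌊(F : ℝ) * R⌋₊ := by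
    exact_mod_cast (show F * N ≤ ⌊(F : ℝ) * M⌋₊ * s + 2 * ⌊(F : ℝ) * R⌋₊ by omega)
  have hF' : (0 : ℝ) < F := by exact_mod_cast hF
  have h₁ : (⌊(F : ℝ) * M⌋₊ : ℝ) * s ≤ F * M * s :=
    mul_le_mul_of_nonneg_right (Nat.floor_le (by positivity)) (by positivity)
  have h₂ : (⌊(F : ℝ) * R⌋₊ : ℝ) ≤ F * R := Nat.floor_le (by positivity)
  refine le_of_mul_le_mul_left ?_ hF'
  linarith

/-- The cut-set bound with `⌈N / 2⌉` users. -/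
theorem Achievable.le_half_users {N K : ℕ} {M R : ℝ} (h : Achievable N K R M) (hM : 0 ≤ M)
    (hN : 0 < N) (hK : N ≤ K) : (N : ℝ) ≤ ((N + 1) / 2 : ℕ) * M + 2 * R := by
  refine h.le_of_two_demands hM (fun i => ⟨i, by omega⟩)
    -- User `i` asks for file `i`, then for file `i + ⌈N/2⌉`; the `min` only keeps indices in range.
    (fun k => ⟨min k (N - 1), by omega⟩)
    (fun k => ⟨min (k + (N + 1) / 2) (N - 1), by omega⟩) fun n => ?_
  by_cases hn : (n : ℕ) < (N + 1) / 2
  · refine ⟨⟨n, hn⟩, Or.inl (Fin.ext ?_)⟩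
    simp only
    omega
  · refine ⟨⟨n - (N + 1) / 2, by omega⟩, Or.inr (Fin.ext ?_)⟩
    simp only
    omega

/-- The condition `M ≤ N / K` makes the term `N / (2 * K)` in the rate pay for the excess `M / 2`
due to rounding `N / 2` up. -/
theorem Achievable.half_proposedRate_le {N K : ℕ} {M R : ℝ} (h : Achievable N K R M)
    (hN : 0 < N) (hK : N ≤ K) (hM : 0 ≤ M) (hM₂ : M ≤ ((N : ℝ) - 1) / (K : ℝ)) :
    proposedRate N K M / 2 ≤ R := by
  have hcut := h.le_half_users hM hN hK
  have hs : (((N + 1) / 2 : ℕ) : ℝ) ≤ (N + 1) / 2 := by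
    simpa using Nat.cast_div_le (m := N + 1) (n := 2) (α := ℝ)
  have hK0 : (0 : ℝ) < K := by exact_mod_cast hN.trans_le hK
  have hMN : M ≤ N / K := hM₂.trans (by gcongr; linarith)
  have hsM := mul_le_mul_of_nonneg_right hs hM
  have e : proposedRate N K M = N - N * M / 2 - N / K / 2 := by
    rw [proposedRate]
    field_simp
    ring
  linarith

/-- For `K > N ≥ 3` and `1 / K ≤ M ≤ (N - 1) / K`, the rate `R_c(M)` is achieved (every larger
rate is achievable with cache capacity `M`), and it is within a factor `2` of the optimal rate
`R*(M)`, which is positive. -/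
theorem theorem2 (N K : ℕ) (hN : 3 ≤ N) (hK : N < K) (M : ℝ)
    (hM₁ : 1 / (K : ℝ) ≤ M) (hM₂ : M ≤ ((N : ℝ) - 1) / (K : ℝ)) :
    (∀ R : ℝ, proposedRate N K M < R → Achievable N K R M) ∧
      0 < optimalRate N K M ∧
      proposedRate N K M / optimalRate N K M ≤ 2 := by
  have hach : ∀ R : ℝ, proposedRate N K M < R → Achievable N K R M := fun R =>
    achievable_of_proposedRate_lt (by omega) hK hM₁ hM₂
  have hpos : 0 < proposedRate N K M := proposedRate_pos (by omega) hK hM₂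
  have hM : 0 ≤ M := le_trans (by positivity) hM₁
  have hlow : proposedRate N K M / 2 ≤ optimalRate N K M :=
    le_csInf ⟨_, hach _ (lt_add_one _)⟩ fun R hR =>
      Achievable.half_proposedRate_le hR (by omega) hK.le hM hM₂
  have hopt : 0 < optimalRate N K M := by linarith
  refine ⟨hach, hopt, ?_⟩
  rw [div_le_iff₀ hopt]
  linarith
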